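/- Let $d\in\mathbb N$, let $I=(a,b)\subset\mathbb R$ with $a<b$, and let $W:\mathbb R^d\times\mathbb R^d\to\mathbb R$ be lower semicontinuous and - coercive: there is $C>0$ with $C\,|(\xi,\eta)|\le W(\xi,\eta)$ for all $\xi,\eta\in\mathbb R^d$; - symmetric: $W(\xi,\eta)=W(\eta,\xi)$ for all $\xi,\eta\in\mathbb R^d$; - diagonal: $W(\xi,\xi)\le c$ and $W(\eta,\eta)\le c$ whenever $W(\xi,\eta)\le c$, for all $\xi,\eta\in\mathbb R^d$ and $c\in\mathbb R$. Let $W^{1,\infty}(I;\mathbb R^d)$ be the space of all $u\in L^\infty(I;\mathbb R^d)$ with weak derivative $u'\in L^\infty(I;\mathbb R^d)$. Its weak* topology is the coarsest one for which $u\mapsto\int_I u\cdot f\,dx$ and $u\mapsto\int_I u'\cdot f\,dx$ are continuous for every $f\in L^1(I;\mathbb R^d)$. Define $$J(u):=\operatorname*{ess\,sup}_{(x,y)\in I\times I}W(u'(x),u'(y))\in(-\infty,+\infty],\qquad u\in W^{1,\infty}(I;\mathbb R^d).$$ Then $J$ is lower semicontinuous with respect to the weak* topology of $W^{1,\infty}(I;\mathbb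 R^d)$ if and only if $W$ is Cartesian level convex, that is, if and only if for every $c\in\mathbb R$ the sublevel set $E=\{(\xi,\eta)\in\mathbb R^d\times\mathbb R^d: W(\xi,\eta)\le c\}$ satisfies: for every $A\subset\mathbb R^d$, $A\times A\subset E$ implies $\operatorname{co}(A)\times\operatorname{co}(A)\subset E$, where $\operatorname{co}(A)$ is the convex hull of $A$. The same equivalence holds with sequential weak* lower semicontinuity, that is, $J(u)\le\liminf_{k\to\infty}J(u_k)$ whenever $u_k\to u$ weakly* in $W^{1,\infty}(I;\mathbb R^d)$. -/

import Mathlib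

open MeasureTheory Filter Topology
open scoped ENNReal

noncomputable section

namespace NonlocalSup

/-- The Euclidean space `ℝ^d`. -/
abbrev Vec (d : ℕ) : Type := EuclideanSpace ℝ (Fin d)

/-- Lebesgue measure on the interval `I = (a, b)`. -/
abbrev volI (a b : ℝ) : Measure ℝ := volume.restrict (Set.Ioo a b)

/-- `L^∞(I; ℝ^d)`. -/
abbrev LInf (a b : ℝ) (d : ℕ) : Type := Lp (Vec d) (⊤ : ℝ≥0∞) (volI a b)

/-- `L^1(I; ℝ^d)`, the predual of `L^∞(I; ℝ^d)`. -/
abbrev LOne (a b : ℝ) (d : ℕ) : Type := Lp (Vec d) (1 : ℝ≥0∞) (volI a b)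

/-- `g` is a weak (distributional) derivative of `u` on `I = (a, b)`:
`∫_I φ' u = - ∫_I φ g` for all `φ ∈ C_c^∞(I)`. -/
def IsWeakDeriv {a b : ℝ} {d : ℕ} (u g : LInf a b d) : Prop :=
  ∀ φ : ℝ → ℝ, ContDiff ℝ ((⊤ : ℕ∞) : WithTop ℕ∞) φ → HasCompactSupport φ →
    tsupport φ ⊆ Set.Ioo a b →
      ∫ x, deriv φ x • u x ∂(volI a b) = - ∫ x, φ x • g x ∂(volI a b)

/-- Weak derivatives are unique as elements of `L^∞`. -/
theorem IsWeakDeriv.unique {a b : ℝ} {d : ℕ} {u g h : LInf a b d}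
    (hg : IsWeakDeriv u g) (hh : IsWeakDeriv u h) : g = h := by
  have ig : Integrable g (volI a b) := (Lp.memLp g).integrable le_top
  have ih : Integrable h (volI a b) := (Lp.memLp h).integrable le_top
  have key : ∀ᵐ x ∂(volI a b), x ∈ Set.Ioo a b → (fun x => g x - h x) x = 0 := by
    refine IsOpen.ae_eq_zero_of_integral_contDiff_smul_eq_zero isOpen_Ioo
      ((ig.sub ih).locallyIntegrable.locallyIntegrableOn _) ?_
    intro φ h1 h2 h3
    have e := (hg φ h1 h2 h3).symm.trans (hh φ h1 h2 h3)
    obtain ⟨C, hC⟩ := h2.exists_bound_of_continuous h1.continuous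
    have m : AEStronglyMeasurable φ (volI a b) := h1.continuous.aestronglyMeasurable
    have jg : Integrable (fun x => φ x • g x) (volI a b) :=
      ig.bdd_smul C m (Eventually.of_forall hC)
    have jh : Integrable (fun x => φ x • h x) (volI a b) :=
      ih.bdd_smul C m (Eventually.of_forall hC)
    simp only [smul_sub]
    rw [integral_sub jg jh, neg_inj.mp e, sub_self]
  apply Lp.ext
  filter_upwards [key, ae_restrict_mem measurableSet_Ioo] with x hx hm
  exact sub_eq_zero.mp (hx hm)

/-- The Sobolev space `W^{1,∞}(I; ℝ^d)`, `I = (a, b)`: the `L^∞` functions having a weak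
derivative in `L^∞`. -/
def W1Inf (a b : ℝ) (d : ℕ) : Type :=
  {u : LInf a b d // ∃ g : LInf a b d, IsWeakDeriv u g}

/-- The function underlying an element of `W^{1,∞}(I; ℝ^d)`. -/
def W1Inf.toLInf {a b : ℝ} {d : ℕ} (u : W1Inf a b d) : LInf a b d := u.1

/-- The weak derivative `u'` of `u ∈ W^{1,∞}(I; ℝ^d)`. -/
def W1Inf.weakDeriv {a b : ℝ} {d : ℕ} (u : W1Inf a b d) : LInf a b d := u.2.choose

theorem W1Inf.isWeakDeriv {a b : ℝ} {d : ℕ} (u : W1Inf a b d) :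
    IsWeakDeriv u.toLInf u.weakDeriv := u.2.choose_spec

theorem W1Inf.weakDeriv_eq {a b : ℝ} {d : ℕ} (u : W1Inf a b d) {g : LInf a b d}
    (hg : IsWeakDeriv u.toLInf g) : u.weakDeriv = g := u.isWeakDeriv.unique hg

/-- The duality pairing `∫_I v · f` between `v ∈ L^∞(I; ℝ^d)` and `f ∈ L^1(I; ℝ^d)`. -/
def pairing {a b : ℝ} {d : ℕ} (v : LInf a b d) (f : LOne a b d) : ℝ :=
  ∫ x, inner ℝ (v x) (f x) ∂(volI a b)

/-- The weak* topology of `W^{1,∞}(I; ℝ^d)`, i.e. the topology induced by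
`u ↦ (u, u') ∈ L^∞ × L^∞` from the weak* topologies `σ(L^∞, L^1)` of the factors: the
coarsest topology making `u ↦ ∫_I u · f` and `u ↦ ∫_I u' · f` continuous for all
`f ∈ L^1(I; ℝ^d)`. The function spaces `L^1 → ℝ` carry the product topology. -/
instance W1Inf.weakStarTopology (a b : ℝ) (d : ℕ) : TopologicalSpace (W1Inf a b d) :=
  TopologicalSpace.induced
    (fun u : W1Inf a b d =>
      ((fun f => pairing u.toLInf f, fun f => pairing u.weakDeriv f) :
        (LOne a b d → ℝ) × (LOne a b d → ℝ)))
    inferInstance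

/-- Weak* convergence in `W^{1,∞}` is weak* convergence in `L^∞` of the functions and of
their derivatives. -/
theorem W1Inf.tendsto_iff {a b : ℝ} {d : ℕ} {ι : Type*} {l : Filter ι}
    {v : ι → W1Inf a b d} {u : W1Inf a b d} :
    Tendsto v l (𝓝 u) ↔
      (∀ f : LOne a b d,
        Tendsto (fun i => pairing (v i).toLInf f) l (𝓝 (pairing u.toLInf f))) ∧
      (∀ f : LOne a b d,
        Tendsto (fun i => pairing (v i).weakDeriv f) l (𝓝 (pairing u.weakDeriv f))) := by
  rw [nhds_induced, tendsto_comap_iff, Prod.tendsto_iff, tendsto_pi_nhds, tendsto_pi_nhds]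
  rfl

/-- The nonlocal supremal functional `J(u) = esssup_{I × I} W(u'(x), u'(y))`, with values in
the extended reals. -/
def supFunctional {d : ℕ} (a b : ℝ) (W : Vec d × Vec d → ℝ) (u : W1Inf a b d) : EReal :=
  essSup (fun z : ℝ × ℝ => ((W (u.weakDeriv z.1, u.weakDeriv z.2) : ℝ) : EReal))
    ((volI a b).prod (volI a b))

/-- Sequential lower semicontinuity. -/
def SeqLowerSemicontinuous {X : Type*} [TopologicalSpace X] (J : X → EReal) : Prop :=
  ∀ (v : ℕ → X) (u : X), Tendsto v atTop (𝓝 u) → J u ≤ liminf (fun k => J (v k)) atTop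

/-- The sublevel set `L_c(W) = {(ξ, η) | W(ξ, η) ≤ c}`. -/
def sublevel {d : ℕ} (W : Vec d × Vec d → ℝ) (c : ℝ) : Set (Vec d × Vec d) :=
  {p | W p ≤ c}

/-- `W` is coercive: `C |(ξ, η)| ≤ W(ξ, η)` for some `C > 0`, with the Euclidean norm of
`(ξ, η) ∈ ℝ^d × ℝ^d`. -/
def IsCoercive {d : ℕ} (W : Vec d × Vec d → ℝ) : Prop :=
  ∃ C : ℝ, 0 < C ∧ ∀ ξ η : Vec d, C * Real.sqrt (‖ξ‖ ^ 2 + ‖η‖ ^ 2) ≤ W (ξ, η)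

/-- `W` is symmetric. -/
def IsSymm {d : ℕ} (W : Vec d × Vec d → ℝ) : Prop :=
  ∀ ξ η : Vec d, W (ξ, η) = W (η, ξ)

/-- `W` is diagonal: `(ξ, η) ∈ L_c(W)` implies `(ξ, ξ), (η, η) ∈ L_c(W)`, for every `c`. -/
def IsDiag {d : ℕ} (W : Vec d × Vec d → ℝ) : Prop :=
  ∀ (c : ℝ) (ξ η : Vec d), (ξ, η) ∈ sublevel W c →
    (ξ, ξ) ∈ sublevel W c ∧ (η, η) ∈ sublevel W c

/-- `E ⊆ ℝ^d × ℝ^d` is Cartesian convex: `A × A ⊆ E` implies `co A × co A ⊆ E`. -/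
def CartesianConvex {d : ℕ} (E : Set (Vec d × Vec d)) : Prop :=
  ∀ A : Set (Vec d), A ×ˢ A ⊆ E → (convexHull ℝ A) ×ˢ (convexHull ℝ A) ⊆ E

/-- `W` is Cartesian level convex: every sublevel set is Cartesian convex. -/
def CartesianLevelConvex {d : ℕ} (W : Vec d × Vec d → ℝ) : Prop :=
  ∀ c : ℝ, CartesianConvex (sublevel W c)

end NonlocalSup

end

open MeasureTheory Filter Topology
open scoped ENNReal

noncomputable section

namespace NonlocalSup

variable {a b : ℝ} {d : ℕ}

/-! ### Sublevel sets of the functional -/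

/-! Fix `c` and write E for the closed sublevel set of W. Then J(u) ≤ c means that (u'(x), u'(y)) ∈
E for almost all (x, y).

Sufficiency: if E is Cartesian convex, this is equivalent to requiring that all pairs of averages of
u' over sets of positive measure lie in E. One direction uses the essential range A of u', for which
A × A ⊆ E (`average_pair_mem`); the other is Lebesgue differentiation
(`ae_prod_mem_of_average_mem`). Averages are weak* continuous, so {J ≤ c} is an intersection of
weak* closed sets.

Necessity: given p, q, r, s in A with A × A ⊆ E, fast zigzags with slopes p, q on the left of an
interior point and r, s on its right keep J ≤ c. They converge weakly* to a function with one slope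
on each side, any chosen convex combinations ξ of p, q and η of r, s; hence (ξ, η) ∈ E. Zorn's lemma
passes from segments to the full convex hull (`cartesianConvex_of_convexJoin`). -/

theorem supFunctional_le_iff {W : Vec d × Vec d → ℝ} {u : W1Inf a b d} {c : ℝ} :
    supFunctional a b W u ≤ (c : EReal) ↔
      ∀ᵐ z ∂((volI a b).prod (volI a b)),
        (u.weakDeriv z.1, u.weakDeriv z.2) ∈ sublevel W c := by
  constructor
  · intro h
    filter_upwards [ae_le_essSup (μ := (volI a b).prod (volI a b))
      (f := fun z : ℝ × ℝ => ((W (u.weakDeriv z.1, u.weakDeriv z.2) : ℝ) : EReal))] with z hz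
    exact EReal.coe_le_coe_iff.mp (hz.trans h)
  · intro h
    refine essSup_le_of_ae_le _ ?_
    filter_upwards [h] with z hz
    exact EReal.coe_le_coe_iff.mpr hz

theorem volI_ne_zero (hab : a < b) : volI a b ≠ 0 := by
  simp [Measure.restrict_eq_zero, hab]

/-- The product measure is nonzero, so some real value of W lies below the essential supremum. This
settles the level ⊥. -/
theorem bot_lt_supFunctional (hab : a < b) (W : Vec d × Vec d → ℝ) (u : W1Inf a b d) :
    ⊥ < supFunctional a b W u := by
  have : NeZero (volI a b) := ⟨volI_ne_zero hab⟩
  have : NeZero ((volI a b).prod (volI a b)) := ⟨by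
    rw [← Measure.measure_univ_ne_zero, ← Set.univ_prod_univ, Measure.prod_prod]
    exact mul_ne_zero (Measure.measure_univ_ne_zero.mpr (volI_ne_zero hab))
      (Measure.measure_univ_ne_zero.mpr (volI_ne_zero hab))⟩
  obtain ⟨z, hz⟩ := (ae_le_essSup (μ := (volI a b).prod (volI a b))
      (f := fun z : ℝ × ℝ => ((W (u.weakDeriv z.1, u.weakDeriv z.2) : ℝ) : EReal))).exists
  exact (EReal.bot_lt_coe _).trans_le hz

/-! ### Essential ranges and averages -/

/-- If `(g x, g y)` lies in a closed set `E` for almost all `(x, y)`, then `g` takes almost all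
its values in a set `A` with `A × A ⊆ E`, namely in its essential range. -/
theorem exists_prod_subset_of_ae_prod {α X : Type*} [MeasurableSpace α] {μ : Measure α}
    [SFinite μ] [TopologicalSpace X] [SecondCountableTopology X] [MeasurableSpace X]
    [OpensMeasurableSpace X] {g : α → X}
    (hg : AEMeasurable g μ) {E : Set (X × X)} (hE : IsClosed E)
    (h : ∀ᵐ z ∂(μ.prod μ), (g z.1, g z.2) ∈ E) :
    ∃ A : Set X, A ×ˢ A ⊆ E ∧ ∀ᵐ x ∂μ, g x ∈ A := by
  refine ⟨(μ.map g).support, ?_, ae_of_ae_map hg Measure.support_mem_ae⟩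
  rintro ⟨ξ, η⟩ ⟨hξ, hη⟩
  rw [← hE.closure_eq, mem_closure_iff_nhds]
  intro t ht
  obtain ⟨U, V, hU, hξU, hV, hηV, hUV⟩ := mem_nhds_prod_iff'.mp ht
  have hfreq : ∀ {O : Set X} {ζ : X}, ζ ∈ (μ.map g).support → IsOpen O → ζ ∈ O →
      ∃ᵐ x ∂μ, g x ∈ O := by
    intro O ζ hζ hO hζO hnot
    have hpos := (Measure.mem_support_iff_forall ζ).mp hζ O (hO.mem_nhds hζO)
    rw [Measure.map_apply_of_aemeasurable hg hO.measurableSet] at hpos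
    refine hpos.ne' ?_
    exact measure_eq_zero_iff_ae_notMem.mpr hnot
  -- Fubini: choose x first, such that almost every y is good for it, then y.
  obtain ⟨x, hxU, hx⟩ := ((hfreq hξ hU hξU).and_eventually (Measure.ae_ae_of_ae_prod h)).exists
  obtain ⟨y, hyV, hy⟩ := ((hfreq hη hV hηV).and_eventually hx).exists
  exact ⟨(g x, g y), hUV ⟨hxU, hyV⟩, hy⟩

theorem LInf.integrable (v : LInf a b d) : Integrable v (volI a b) :=
  (Lp.memLp v).integrable le_top

/-- Averages of a function with values in A lie in the closure of co A. As E is closed, it contains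
the closure of co A × co A, which is the product of the closures. -/
theorem average_pair_mem {E : Set (Vec d × Vec d)} (hE : IsClosed E) (hcc : CartesianConvex E)
    {v : LInf a b d}
    (h : ∀ᵐ z ∂((volI a b).prod (volI a b)), (v z.1, v z.2) ∈ E) {s t : Set ℝ}
    (hs : volI a b s ≠ 0) (ht : volI a b t ≠ 0) :
    (⨍ x in s, v x ∂(volI a b), ⨍ x in t, v x ∂(volI a b)) ∈ E := by
  obtain ⟨A, hA, hvA⟩ := exists_prod_subset_of_ae_prod
    (Lp.aestronglyMeasurable v).aemeasurable hE h
  have hmem : ∀ s : Set ℝ, volI a b s ≠ 0 →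
      ⨍ x in s, v x ∂(volI a b) ∈ closure (convexHull ℝ A) := fun s hs =>
    (convex_convexHull ℝ A).set_average_mem_closure hs (measure_ne_top _ _)
      (ae_restrict_of_ae (hvA.mono fun x hx => subset_convexHull ℝ A hx))
      v.integrable.integrableOn
  have hcl := closure_mono (hcc A hA)
  rw [closure_prod_eq, hE.closure_eq] at hcl
  exact hcl ⟨hmem s hs, hmem t ht⟩

theorem tendsto_average_closedBall (v : LInf a b d) :
    ∀ᵐ x ∂(volI a b), Tendsto (fun r => ⨍ y in Metric.closedBall x r, v y ∂(volI a b))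
      (𝓝[>] 0) (𝓝 (v x)) := by
  filter_upwards [(Besicovitch.vitaliFamily (volI a b)).ae_tendsto_average
    v.integrable.locallyIntegrable] with x hx
  exact hx.comp (Besicovitch.tendsto_filterAt _ x)

theorem volI_closedBall_ne_zero {x r : ℝ} (hx : x ∈ Set.Ioo a b) (hr : 0 < r) :
    volI a b (Metric.closedBall x r) ≠ 0 := by
  refine ne_of_gt ?_
  rw [Measure.restrict_apply measurableSet_closedBall]
  exact Measure.measure_pos_of_mem_nhds _
    (inter_mem (Metric.closedBall_mem_nhds x hr) (isOpen_Ioo.mem_nhds hx))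

/-- For almost all (x, y) both coordinates are Lebesgue points of v, and (v x, v y) is a limit of
pairs of ball averages. -/
theorem ae_prod_mem_of_average_mem {E : Set (Vec d × Vec d)} (hE : IsClosed E) {v : LInf a b d}
    (h : ∀ s t : Set ℝ, MeasurableSet s → MeasurableSet t → volI a b s ≠ 0 → volI a b t ≠ 0 →
      (⨍ x in s, v x ∂(volI a b), ⨍ x in t, v x ∂(volI a b)) ∈ E) :
    ∀ᵐ z ∂((volI a b).prod (volI a b)), (v z.1, v z.2) ∈ E := by
  have hmem : ∀ᵐ x ∂(volI a b), x ∈ Set.Ioo a b := ae_restrict_mem measurableSet_Ioo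
  have hlim := tendsto_average_closedBall v
  filter_upwards [Measure.quasiMeasurePreserving_fst.ae hmem,
    Measure.quasiMeasurePreserving_snd.ae hmem, Measure.quasiMeasurePreserving_fst.ae hlim,
    Measure.quasiMeasurePreserving_snd.ae hlim] with z h1 h2 l1 l2
  refine hE.mem_of_tendsto (l1.prodMk_nhds l2) ?_
  filter_upwards [self_mem_nhdsWithin] with r hr
  exact h _ _ measurableSet_closedBall measurableSet_closedBall (volI_closedBall_ne_zero h1 hr)
    (volI_closedBall_ne_zero h2 hr)

/-! ### Weak* continuity of averages, and sufficiency -/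

theorem continuous_pairing_weakDeriv (f : LOne a b d) :
    Continuous fun u : W1Inf a b d => pairing u.weakDeriv f :=
  continuous_iff_continuousAt.mpr fun _ => (W1Inf.tendsto_iff.mp tendsto_id).2 f

theorem inner_setIntegral_eq_pairing (v : LInf a b d) {s : Set ℝ} (hs : MeasurableSet s)
    (e : Vec d) :
    inner ℝ e (∫ x in s, v x ∂(volI a b)) =
      pairing v (indicatorConstLp 1 hs (measure_ne_top (volI a b) s) e) := by
  rw [← integral_inner v.integrable.integrableOn, ← integral_indicator hs, pairing]
  refine integral_congr_ae ?_
  filter_upwards [indicatorConstLp_coeFn (p := 1) (hs := hs)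
    (hμs := measure_ne_top (volI a b) s) (c := e)] with x hx
  rw [hx]
  by_cases hxs : x ∈ s <;> simp [hxs, real_inner_comm]

/-- Each coordinate of the integral is the pairing with an indicator times a basis vector, an L¹
test function. -/
theorem continuous_setIntegral_weakDeriv {s : Set ℝ} (hs : MeasurableSet s) :
    Continuous fun u : W1Inf a b d => ∫ x in s, u.weakDeriv x ∂(volI a b) := by
  have : ∀ u : W1Inf a b d, ∫ x in s, u.weakDeriv x ∂(volI a b) =
      ∑ i, inner ℝ (EuclideanSpace.basisFun (Fin d) ℝ i) (∫ x in s, u.weakDeriv x ∂(volI a b)) •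
        EuclideanSpace.basisFun (Fin d) ℝ i := fun u =>
    ((EuclideanSpace.basisFun (Fin d) ℝ).sum_repr' _).symm
  rw [funext this]
  simp only [inner_setIntegral_eq_pairing _ hs]
  exact continuous_finsetSum _ fun i _ => (continuous_pairing_weakDeriv _).smul continuous_const

theorem continuous_setAverage_weakDeriv {s : Set ℝ} (hs : MeasurableSet s) :
    Continuous fun u : W1Inf a b d => ⨍ x in s, u.weakDeriv x ∂(volI a b) := by
  simp_rw [setAverage_eq]
  exact (continuous_setIntegral_weakDeriv hs).const_smul ((volI a b).real s)⁻¹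

/-- Cartesian level convexity is sufficient for weak* lower semicontinuity. -/
theorem CartesianLevelConvex.lowerSemicontinuous (hab : a < b) {W : Vec d × Vec d → ℝ}
    (hlsc : LowerSemicontinuous W) (hW : CartesianLevelConvex W) :
    LowerSemicontinuous (supFunctional a b W) := by
  rw [lowerSemicontinuous_iff_isClosed_preimage]
  intro c
  induction c with
  | bot =>
    convert isClosed_empty
    ext u
    simp [(bot_lt_supFunctional hab W u).ne']
  | top => simp
  | coe c =>
    have hE : IsClosed (sublevel W c) := hlsc.isClosed_preimage c
    have heq : supFunctional a b W ⁻¹' Set.Iic (c : EReal) =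
        ⋂ (s : Set ℝ) (t : Set ℝ) (_ : MeasurableSet s) (_ : MeasurableSet t)
          (_ : volI a b s ≠ 0) (_ : volI a b t ≠ 0),
          (fun u : W1Inf a b d => (⨍ x in s, u.weakDeriv x ∂(volI a b),
            ⨍ x in t, u.weakDeriv x ∂(volI a b))) ⁻¹' sublevel W c := by
      ext u
      rw [Set.mem_preimage, Set.mem_Iic, supFunctional_le_iff]
      simp only [Set.mem_iInter, Set.mem_preimage]
      exact ⟨fun h s t _ _ hs ht => average_pair_mem hE (hW c) h hs ht,
        fun h => ae_prod_mem_of_average_mem hE h⟩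
    rw [heq]
    refine isClosed_iInter fun s => isClosed_iInter fun t => isClosed_iInter fun hs =>
      isClosed_iInter fun ht => isClosed_iInter fun _ => isClosed_iInter fun _ => ?_
    exact hE.preimage
      ((continuous_setAverage_weakDeriv hs).prodMk (continuous_setAverage_weakDeriv ht))

theorem _root_.LowerSemicontinuous.seqLowerSemicontinuous {X : Type*} [TopologicalSpace X]
    {J : X → EReal} (hJ : LowerSemicontinuous J) : SeqLowerSemicontinuous J := by
  intro v u hv
  refine le_of_forall_lt fun c hc => ?_
  obtain ⟨e, hce, heu⟩ := exists_between hc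
  refine hce.trans_le (le_liminf_of_le (by isBoundedDefault) ?_)
  exact (hv.eventually (hJ u e heu)).mono fun _ h => h.le

/-! ### Piecewise differentiable functions as elements of `W^{1,∞}` -/

/-- `u` is continuous and, off a countable set, differentiable with derivative in `A`. -/
def HasDerivIn (A : Set (Vec d)) (u : ℝ → Vec d) : Prop :=
  Continuous u ∧ ∃ S : Set ℝ, S.Countable ∧ ∀ x ∉ S, ∃ v ∈ A, HasDerivAt u v x

theorem _root_.Set.Countable.ae_volI_notMem {S : Set ℝ} (hS : S.Countable) :
    ∀ᵐ x ∂(volI a b), x ∉ S :=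
  ae_restrict_of_ae (hS.ae_notMem volume)

theorem HasDerivIn.ae_deriv_mem {A : Set (Vec d)} {u : ℝ → Vec d} (hu : HasDerivIn A u) :
    ∀ᵐ x ∂(volI a b), deriv u x ∈ A := by
  obtain ⟨-, S, hS, h⟩ := hu
  filter_upwards [hS.ae_volI_notMem] with x hx
  obtain ⟨v, hv, hd⟩ := h x hx
  rwa [hd.deriv]

theorem HasDerivIn.ae_differentiableAt {A : Set (Vec d)} {u : ℝ → Vec d} (hu : HasDerivIn A u) :
    ∀ᵐ x ∂(volI a b), DifferentiableAt ℝ u x := by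
  obtain ⟨-, S, hS, h⟩ := hu
  filter_upwards [hS.ae_volI_notMem] with x hx
  obtain ⟨v, hv, hd⟩ := h x hx
  exact hd.differentiableAt

theorem HasDerivIn.sub {A B : Set (Vec d)} {u v : ℝ → Vec d} (hu : HasDerivIn A u)
    (hv : HasDerivIn B v) : HasDerivIn (Set.image2 (· - ·) A B) (u - v) := by
  obtain ⟨cu, S, hS, h⟩ := hu
  obtain ⟨cv, T, hT, k⟩ := hv
  refine ⟨cu.sub cv, S ∪ T, hS.union hT, fun x hx => ?_⟩
  rw [Set.mem_union, not_or] at hx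
  obtain ⟨p, hp, dp⟩ := h x hx.1
  obtain ⟨q, hq, dq⟩ := k x hx.2
  exact ⟨p - q, Set.mem_image2_of_mem hp hq, dp.sub dq⟩

theorem HasDerivIn.memLp_deriv {A : Set (Vec d)} (hA : Bornology.IsBounded A) {u : ℝ → Vec d}
    (hu : HasDerivIn A u) : MemLp (deriv u) ⊤ (volI a b) := by
  obtain ⟨R, hR⟩ := hA.exists_norm_le
  refine memLp_top_of_bound (measurable_deriv u).aestronglyMeasurable R ?_
  filter_upwards [hu.ae_deriv_mem] with x hx using hR _ hx

theorem _root_.Continuous.memLp_top_volI {u : ℝ → Vec d} (hu : Continuous u) :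
    MemLp u ⊤ (volI a b) := by
  obtain ⟨R, hR⟩ := (isCompact_Icc (a := a) (b := b)).exists_bound_of_continuousOn hu.continuousOn
  refine memLp_top_of_bound hu.aestronglyMeasurable R ?_
  filter_upwards [ae_restrict_mem measurableSet_Ioo] with x hx using
    hR x (Set.Ioo_subset_Icc_self hx)

/-- The product rule, integrated, for a smooth function times a piecewise differentiable one. -/
theorem HasDerivIn.integral_deriv_bilin {F : Type*} [NormedAddCommGroup F] [NormedSpace ℝ F]
    (hab : a ≤ b) {A : Set (Vec d)} (hA : Bornology.IsBounded A) {u : ℝ → Vec d}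
    (hu : HasDerivIn A u) {G : Type*} [NormedAddCommGroup G] [NormedSpace ℝ G] [CompleteSpace G]
    (B : F →L[ℝ] Vec d →L[ℝ] G) {f : ℝ → F} (hf : ContDiff ℝ 1 f) :
    Integrable (fun x => B (f x) (deriv u x)) (volI a b) ∧
    ∫ x, B (f x) (deriv u x) ∂(volI a b) =
      B (f b) (u b) - B (f a) (u a) - ∫ x, B (deriv f x) (u x) ∂(volI a b) := by
  have hdf : Continuous (deriv f) := hf.continuous_deriv le_rfl
  have i1 : Integrable (fun x => B (deriv f x) (u x)) (volI a b) := by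
    have hc : Continuous fun x => B (deriv f x) (u x) := (B.continuous.comp hdf).clm_apply hu.1
    exact (hc.integrableOn_Icc (a := a) (b := b)).mono_set Set.Ioo_subset_Icc_self
  have i2 : Integrable (fun x => B (f x) (deriv u x)) (volI a b) := by
    obtain ⟨R, hR⟩ := hA.exists_norm_le
    have hc : Continuous fun x => B (f x) := B.continuous.comp hf.continuous
    obtain ⟨M, hM⟩ := (isCompact_Icc (a := a) (b := b)).exists_bound_of_continuousOn
      hc.continuousOn
    refine Integrable.of_bound (C := M * R) ?_ ?_
    · exact (ContinuousLinearMap.id ℝ (Vec d →L[ℝ] G)).aestronglyMeasurable_comp₂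
        hc.aestronglyMeasurable (measurable_deriv u).aestronglyMeasurable
    · filter_upwards [hu.ae_deriv_mem, ae_restrict_mem measurableSet_Ioo] with x hx hxI
      exact (B (f x)).le_of_opNorm_le_of_le (hM x (Set.Ioo_subset_Icc_self hxI)) (hR _ hx)
  refine ⟨i2, ?_⟩
  obtain ⟨S, hS, h⟩ := hu.2
  -- Here the exceptional set must be countable, not merely null: Cantor-type functions would
  -- violate the formula.
  have hftc := integral_eq_of_hasDerivAt_off_countable_of_le (fun x => B (f x) (u x))
    (fun x => B (f x) (deriv u x) + B (deriv f x) (u x)) hab hS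
    ((B.continuous.comp hf.continuous).clm_apply hu.1).continuousOn (fun x hx => by
      obtain ⟨v, -, hv⟩ := h x hx.2
      have hfx := (hf.differentiable one_ne_zero x).hasDerivAt
      rw [hv.deriv, add_comm]
      exact (B.hasFDerivAt.comp_hasDerivAt x hfx).clm_apply hv)
    ((intervalIntegrable_iff_integrableOn_Ioo_of_le hab).mpr (i2.add i1))
  rw [intervalIntegral.integral_of_le hab, integral_Ioc_eq_integral_Ioo,
    integral_add i2 i1] at hftc
  exact eq_sub_of_add_eq hftc

theorem HasDerivIn.exists_w1Inf (hab : a ≤ b) {A : Set (Vec d)} (hA : Bornology.IsBounded A)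
    {u : ℝ → Vec d} (hu : HasDerivIn A u) :
    ∃ w : W1Inf a b d, w.toLInf =ᵐ[volI a b] u ∧ w.weakDeriv =ᵐ[volI a b] deriv u := by
  have m1 : MemLp u ⊤ (volI a b) := hu.1.memLp_top_volI
  have m2 : MemLp (deriv u) ⊤ (volI a b) := hu.memLp_deriv hA
  have hw : IsWeakDeriv m1.toLp m2.toLp := by
    intro φ h1 h2 h3
    have hzero : ∀ x ∉ Set.Ioo a b, φ x = 0 := fun x hx =>
      image_eq_zero_of_notMem_tsupport fun hx' => hx (h3 hx')
    -- The boundary terms vanish because φ is supported in the open interval.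
    have key := (hu.integral_deriv_bilin hab hA (ContinuousLinearMap.lsmul ℝ ℝ)
      (h1.of_le (by exact_mod_cast le_top))).2
    simp only [ContinuousLinearMap.lsmul_apply, hzero b (by simp), hzero a (by simp), zero_smul,
      sub_zero, zero_sub] at key
    have e1 : ∫ x, deriv φ x • m1.toLp u x ∂(volI a b) = ∫ x, deriv φ x • u x ∂(volI a b) := by
      refine integral_congr_ae ?_
      filter_upwards [m1.coeFn_toLp] with x hx using by rw [hx]
    have e2 : ∫ x, φ x • m2.toLp (deriv u) x ∂(volI a b) =
        ∫ x, φ x • deriv u x ∂(volI a b) := by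
      refine integral_congr_ae ?_
      filter_upwards [m2.coeFn_toLp] with x hx using by rw [hx]
    rw [e1, e2, key, neg_neg]
  let w : W1Inf a b d := ⟨m1.toLp, m2.toLp, hw⟩
  refine ⟨w, m1.coeFn_toLp, ?_⟩
  rw [w.weakDeriv_eq hw]
  exact m2.coeFn_toLp

/-! ### Weak* convergence -/

theorem abs_integral_inner_le {v f : ℝ → Vec d} (hf : Integrable f (volI a b)) {M : ℝ}
    (hv : ∀ᵐ x ∂(volI a b), ‖v x‖ ≤ M) :
    |∫ x, inner ℝ (v x) (f x) ∂(volI a b)| ≤ M * ∫ x, ‖f x‖ ∂(volI a b) := by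
  rw [← integral_const_mul, ← Real.norm_eq_abs]
  refine norm_integral_le_of_norm_le (hf.norm.const_mul M) ?_
  filter_upwards [hv] with x hx
  exact (norm_inner_le_norm _ _).trans (by gcongr)

theorem integrable_inner_of_bound {v f : ℝ → Vec d} (hf : Integrable f (volI a b)) {M : ℝ}
    (hvm : AEStronglyMeasurable v (volI a b)) (hv : ∀ᵐ x ∂(volI a b), ‖v x‖ ≤ M) :
    Integrable (fun x => inner ℝ (v x) (f x)) (volI a b) := by
  refine (hf.norm.const_mul M).mono' (hvm.inner hf.1) ?_
  filter_upwards [hv] with x hx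
  exact (norm_inner_le_norm _ _).trans (by gcongr)

/-- If functions with uniformly bounded derivatives tend to zero uniformly, then their
derivatives tend to zero weakly*. -/
theorem tendsto_integral_inner_deriv (hab : a ≤ b) {A : Set (Vec d)}
    (hA : Bornology.IsBounded A) {D : ℕ → ℝ → Vec d} (hD : ∀ k, HasDerivIn A (D k)) {δ : ℕ → ℝ}
    (hδ : Tendsto δ atTop (𝓝 0)) (hDδ : ∀ k x, ‖D k x‖ ≤ δ k) {f : ℝ → Vec d}
    (hf : Integrable f (volI a b)) :
    Tendsto (fun k => ∫ x, inner ℝ (deriv (D k) x) (f x) ∂(volI a b)) atTop (𝓝 0) := by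
  obtain ⟨R, hR⟩ := hA.exists_norm_le
  have hbd : ∀ k, ∀ᵐ x ∂(volI a b), ‖deriv (D k) x‖ ≤ |R| := fun k => by
    filter_upwards [(hD k).ae_deriv_mem] with x hx using (hR _ hx).trans (le_abs_self R)
  rw [Metric.tendsto_atTop']
  intro ε hε
  -- Replacing f by a smooth g with L¹ error η costs at most |R| η < ε / 2; the added 1 keeps the
  -- denominator positive.
  set η : ℝ := ε / (2 * (|R| + 1)) with hη
  have hηpos : 0 < η := by positivity
  obtain ⟨g, hgc, hgs, hfg⟩ :=
    (memLp_one_iff_integrable.mpr hf).exist_eLpNorm_sub_le ENNReal.one_ne_top le_rfl hηpos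
  have hgi : Integrable g (volI a b) := hgs.continuous.integrable_of_hasCompactSupport hgc
  have hfgi : ∫ x, ‖f x - g x‖ ∂(volI a b) ≤ η := by
    have := integral_norm_eq_lintegral_enorm (hf.1.sub hgi.1)
    simp only [Pi.sub_apply] at this
    rw [this]
    rw [eLpNorm_one_eq_lintegral_enorm] at hfg
    exact ENNReal.toReal_le_of_le_ofReal hηpos.le hfg
  have hgs1 : ContDiff ℝ 1 g := hgs.of_le (by exact_mod_cast le_top)
  -- Integration by parts moves the derivative onto g. The support of g is compact in ℝ but need not
  -- lie in I, so the boundary terms enter the constant C.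
  have hsmooth : Tendsto (fun k => ∫ x, inner ℝ (deriv (D k) x) (g x) ∂(volI a b)) atTop
      (𝓝 0) := by
    set C : ℝ := ‖g b‖ + ‖g a‖ + ∫ x, ‖deriv g x‖ ∂(volI a b)
    have hdg : Integrable (deriv g) (volI a b) :=
      (hgs1.continuous_deriv le_rfl).integrable_of_hasCompactSupport hgc.deriv
    refine squeeze_zero_norm (a := fun k => δ k * C) (fun k => ?_) (by simpa using hδ.mul_const C)
    have key := ((hD k).integral_deriv_bilin hab hA (innerSL ℝ) hgs1).2
    have hB : ∀ x y : Vec d, innerSL ℝ x y = inner ℝ x y := fun _ _ => rfl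
    simp only [hB] at key
    have h1 : ‖inner ℝ (g b) (D k b)‖ ≤ ‖g b‖ * δ k :=
      (norm_inner_le_norm _ _).trans (by gcongr; exact hDδ k b)
    have h2 : ‖inner ℝ (g a) (D k a)‖ ≤ ‖g a‖ * δ k :=
      (norm_inner_le_norm _ _).trans (by gcongr; exact hDδ k a)
    have h3 : ‖∫ x, inner ℝ (deriv g x) (D k x) ∂(volI a b)‖ ≤
        δ k * ∫ x, ‖deriv g x‖ ∂(volI a b) := by
      simp_rw [real_inner_comm (D k _)]
      exact abs_integral_inner_le hdg (.of_forall (hDδ k))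
    simp_rw [real_inner_comm (g _)]
    rw [key]
    calc _ ≤ ‖g b‖ * δ k + ‖g a‖ * δ k + δ k * ∫ x, ‖deriv g x‖ ∂(volI a b) :=
          (norm_sub_le _ _).trans (add_le_add ((norm_sub_le _ _).trans (add_le_add h1 h2)) h3)
      _ = δ k * C := by ring
  obtain ⟨N, hN⟩ := (Metric.tendsto_atTop'.mp hsmooth) (ε / 2) (half_pos hε)
  refine ⟨N, fun k hk => ?_⟩
  have hm : AEStronglyMeasurable (deriv (D k)) (volI a b) :=
    (measurable_deriv _).aestronglyMeasurable
  have hsplit : ∫ x, inner ℝ (deriv (D k) x) (f x) ∂(volI a b) =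
      ∫ x, inner ℝ (deriv (D k) x) (f x - g x) ∂(volI a b) +
        ∫ x, inner ℝ (deriv (D k) x) (g x) ∂(volI a b) := by
    have hadd := integral_add (integrable_inner_of_bound (hf.sub hgi) hm (hbd k))
      (integrable_inner_of_bound hgi hm (hbd k))
    simpa [← inner_add_right] using hadd
  have h1 : |∫ x, inner ℝ (deriv (D k) x) (f x - g x) ∂(volI a b)| < ε / 2 := by
    refine (abs_integral_inner_le (hf.sub hgi) (hbd k)).trans_lt ?_
    calc |R| * ∫ x, ‖f x - g x‖ ∂(volI a b) ≤ |R| * η := by gcongr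
      _ < (|R| + 1) * η := by gcongr; linarith
      _ = ε / 2 := by rw [hη]; field_simp
  have h2 := hN k hk
  rw [Real.dist_0_eq_abs] at h2 ⊢
  rw [hsplit]
  linarith [abs_add_le (∫ x, inner ℝ (deriv (D k) x) (f x - g x) ∂(volI a b))
    (∫ x, inner ℝ (deriv (D k) x) (g x) ∂(volI a b))]

theorem W1Inf.tendsto_of_hasDerivIn (hab : a ≤ b) {A B : Set (Vec d)}
    (hA : Bornology.IsBounded A) (hB : Bornology.IsBounded B) {u : ℕ → ℝ → Vec d} {v : ℝ → Vec d}
    (hu : ∀ k, HasDerivIn A (u k)) (hv : HasDerivIn B v) {δ : ℕ → ℝ}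
    (hδ : Tendsto δ atTop (𝓝 0)) (huv : ∀ k x, ‖u k x - v x‖ ≤ δ k)
    {w : ℕ → W1Inf a b d} {z : W1Inf a b d}
    (hw : ∀ k, (w k).toLInf =ᵐ[volI a b] u k) (hw' : ∀ k, (w k).weakDeriv =ᵐ[volI a b] deriv (u k))
    (hz : z.toLInf =ᵐ[volI a b] v) (hz' : z.weakDeriv =ᵐ[volI a b] deriv v) :
    Tendsto w atTop (𝓝 z) := by
  have hpair : ∀ (g : LInf a b d) (f : LOne a b d),
      Integrable (fun x => inner ℝ (g x) (f x)) (volI a b) := fun g f => by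
    obtain ⟨M, hM⟩ : ∃ M : ℝ, ∀ᵐ x ∂(volI a b), ‖g x‖ ≤ M :=
      ⟨_, ae_le_lpNorm_exponent_top (Lp.memLp g)⟩
    exact integrable_inner_of_bound (L1.integrable_coeFn f) (Lp.aestronglyMeasurable g) hM
  rw [W1Inf.tendsto_iff]
  constructor
  · intro f
    rw [← tendsto_sub_nhds_zero_iff]
    refine squeeze_zero_norm (a := fun k => δ k * ∫ x, ‖f x‖ ∂(volI a b)) (fun k => ?_)
      (by simpa using hδ.mul_const (∫ x, ‖f x‖ ∂(volI a b)))
    rw [pairing, pairing, ← integral_sub (hpair _ f) (hpair _ f)]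
    simp_rw [← inner_sub_left]
    refine abs_integral_inner_le (L1.integrable_coeFn f) ?_
    filter_upwards [hw k, hz] with x h1 h2
    rw [h1, h2]
    exact huv k x
  · intro f
    rw [← tendsto_sub_nhds_zero_iff]
    refine (tendsto_integral_inner_deriv hab (Bornology.IsBounded.sub hA hB) (fun k => (hu k).sub hv) hδ huv
      (L1.integrable_coeFn f)).congr fun k => ?_
    rw [pairing, pairing, ← integral_sub (hpair _ f) (hpair _ f)]
    refine integral_congr_ae ?_
    filter_upwards [hw' k, hz', (hu k).ae_differentiableAt, hv.ae_differentiableAt]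
      with x h1 h2 h3 h4
    rw [h1, h2, deriv_sub h3 h4, inner_sub_left]

/-! ### Oscillating functions -/

/-- The `1`-periodic function vanishing at the integers whose slope is `1 - t` on `(0, t)` and
`-t` on `(t, 1)`. -/
def sawtooth (t x : ℝ) : ℝ := min ((1 - t) * Int.fract x) (t * (1 - Int.fract x))

theorem sawtooth_zero {t : ℝ} (ht : 0 ≤ t) : sawtooth t 0 = 0 := by
  simp [sawtooth, ht]

theorem continuous_sawtooth {t : ℝ} (h0 : 0 ≤ t) (h1 : t ≤ 1) : Continuous (sawtooth t) := by
  refine ContinuousOn.comp_fract'' (f := fun y : ℝ => min ((1 - t) * y) (t * (1 - y))) ?_ ?_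
  · fun_prop
  · simp [h0, h1]

theorem abs_sawtooth_le_one {t : ℝ} (h0 : 0 ≤ t) (h1 : t ≤ 1) (x : ℝ) : |sawtooth t x| ≤ 1 := by
  have f0 := Int.fract_nonneg x
  have f1 := (Int.fract_lt_one x).le
  have hn : 0 ≤ sawtooth t x :=
    le_min (mul_nonneg (by linarith) f0) (mul_nonneg h0 (by linarith))
  rw [abs_of_nonneg hn]
  exact (min_le_left _ _).trans (by nlinarith)

theorem hasDerivAt_fract {x : ℝ} (hx : Int.fract x ≠ 0) : HasDerivAt (Int.fract : ℝ → ℝ) 1 x := by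
  have hlt : (⌊x⌋ : ℝ) < x := lt_of_le_of_ne (Int.floor_le x) fun h => hx (by
    rw [Int.fract, h, sub_self])
  have hev : (Int.fract : ℝ → ℝ) =ᶠ[𝓝 x] fun y => y - ⌊x⌋ := by
    filter_upwards [Ioo_mem_nhds hlt (Int.lt_floor_add_one x)] with y hy
    rw [Int.fract, Int.floor_eq_iff.mpr ⟨hy.1.le, hy.2⟩]
  exact ((hasDerivAt_id x).sub_const _).congr_of_eventuallyEq hev

theorem hasDerivAt_sawtooth {t x : ℝ} (hx : Int.fract x ≠ 0) (hxt : Int.fract x ≠ t) :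
    HasDerivAt (sawtooth t) (1 - t) x ∨ HasDerivAt (sawtooth t) (-t) x := by
  have hf := hasDerivAt_fract hx
  rcases lt_or_gt_of_ne hxt with h | h
  · left
    have hev : sawtooth t =ᶠ[𝓝 x] fun y => (1 - t) * Int.fract y := by
      filter_upwards [hf.continuousAt.eventually_lt_const h] with y hy
      exact min_eq_left (by linarith)
    simpa using (hf.const_mul (1 - t)).congr_of_eventuallyEq hev
  · right
    have hev : sawtooth t =ᶠ[𝓝 x] fun y => t * (1 - Int.fract y) := by
      filter_upwards [hf.continuousAt.eventually_const_lt h] with y hy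
      exact min_eq_right (by linarith)
    simpa using ((hf.const_sub 1).const_mul t).congr_of_eventuallyEq hev

theorem countable_fract_eq (r : ℝ) : {x : ℝ | Int.fract x = r}.Countable := by
  refine (Set.countable_range fun n : ℤ => (n : ℝ) + r).mono ?_
  rintro x rfl
  exact ⟨⌊x⌋, Int.floor_add_fract x⟩

/-- The function with slopes in `{p, q}` oscillating around the line with slope
`t • p + (1 - t) • q`, at frequency `n`. -/
def zigzag (t : ℝ) (p q : Vec d) (n x : ℝ) : Vec d :=
  x • (t • p + (1 - t) • q) + (n⁻¹ * sawtooth t (n * x)) • (p - q)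

theorem zigzag_zero {t : ℝ} (ht : 0 ≤ t) (p q : Vec d) (n : ℝ) : zigzag t p q n 0 = 0 := by
  simp [zigzag, sawtooth_zero ht]

theorem norm_zigzag_sub_le {t : ℝ} (h0 : 0 ≤ t) (h1 : t ≤ 1) (p q : Vec d) {n : ℝ} (hn : 0 < n)
    (x : ℝ) : ‖zigzag t p q n x - x • (t • p + (1 - t) • q)‖ ≤ n⁻¹ * ‖p - q‖ := by
  rw [zigzag, add_sub_cancel_left, norm_smul, norm_mul, Real.norm_eq_abs, Real.norm_eq_abs,
    abs_of_pos (inv_pos.mpr hn)]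
  gcongr
  exact mul_le_of_le_one_right (inv_nonneg.mpr hn.le) (abs_sawtooth_le_one h0 h1 _)

/-- The factor n⁻¹ cancels the chain-rule factor n. Adding (1 - t)(p - q) or -t(p - q) to the mean
slope gives p or q. -/
theorem hasDerivIn_zigzag {t : ℝ} (h0 : 0 ≤ t) (h1 : t ≤ 1) (p q : Vec d) {n : ℝ} (hn : n ≠ 0) :
    HasDerivIn {p, q} (zigzag t p q n) := by
  refine ⟨?_, (n * ·) ⁻¹' ({x | Int.fract x = 0} ∪ {x | Int.fract x = t}),
    ((countable_fract_eq 0).union (countable_fract_eq t)).preimage (mul_right_injective₀ hn),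
    fun x hx => ?_⟩
  · have := (continuous_sawtooth h0 h1).comp (continuous_const_mul n)
    unfold zigzag
    exact (continuous_id.smul continuous_const).add
      ((continuous_const.mul this).smul continuous_const)
  · simp only [Set.mem_preimage, Set.mem_union, Set.mem_ofPred_eq, not_or] at hx
    have key : ∀ s : ℝ, HasDerivAt (sawtooth t) s (n * x) →
        HasDerivAt (zigzag t p q n) ((t • p + (1 - t) • q) + s • (p - q)) x := by
      intro s hs
      have h1 : HasDerivAt (fun y => n * y) n x := by
        simpa using (hasDerivAt_id x).const_mul n
      have h2 := ((hs.comp x h1).const_mul n⁻¹).smul_const (p - q)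
      have h3 := ((hasDerivAt_id x).smul_const (t • p + (1 - t) • q)).add h2
      rw [one_smul, mul_comm s, inv_mul_cancel_left₀ hn] at h3
      exact h3
    rcases hasDerivAt_sawtooth hx.1 hx.2 with h | h
    · refine ⟨p, by simp, ?_⟩
      convert key _ h using 1
      module
    · refine ⟨q, by simp, ?_⟩
      convert key _ h using 1
      module

/-- The function that follows `P` up to `m` and `Q` from `m` on. -/
def glue (m : ℝ) (P Q : ℝ → Vec d) (x : ℝ) : Vec d := if x ≤ m then P (x - m) else Q (x - m)

theorem glue_eventuallyEq_left {m x : ℝ} (P Q : ℝ → Vec d) (hx : x < m) :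
    glue m P Q =ᶠ[𝓝 x] fun y => P (y - m) := by
  filter_upwards [Iio_mem_nhds hx] with y hy
  exact if_pos (le_of_lt hy)

theorem glue_eventuallyEq_right {m x : ℝ} (P Q : ℝ → Vec d) (hx : m < x) :
    glue m P Q =ᶠ[𝓝 x] fun y => Q (y - m) := by
  filter_upwards [Ioi_mem_nhds hx] with y hy
  exact if_neg (not_le_of_gt hy)

/-- Both pieces are translated so that the joint sits at their origin; agreement there is all that
continuity needs. -/
theorem hasDerivIn_glue {A B : Set (Vec d)} {P Q : ℝ → Vec d} (m : ℝ) (h0 : P 0 = Q 0)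
    (hP : HasDerivIn A P) (hQ : HasDerivIn B Q) : HasDerivIn (A ∪ B) (glue m P Q) := by
  obtain ⟨cP, S, hS, dP⟩ := hP
  obtain ⟨cQ, T, hT, dQ⟩ := hQ
  have hinj : Function.Injective fun x : ℝ => x - m := sub_left_injective
  refine ⟨?_, {m} ∪ ((· - m) ⁻¹' S ∪ (· - m) ⁻¹' T), (Set.countable_singleton m).union
    ((hS.preimage hinj).union (hT.preimage hinj)), fun x hx => ?_⟩
  · refine Continuous.if_le (by fun_prop) (by fun_prop) continuous_id continuous_const ?_
    rintro x rfl
    simpa using h0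
  · simp only [Set.mem_union, Set.mem_singleton_iff, Set.mem_preimage, not_or] at hx
    rcases lt_or_gt_of_ne hx.1 with h | h
    · obtain ⟨v, hv, hd⟩ := dP _ hx.2.1
      exact ⟨v, .inl hv, (hd.comp_sub_const x m).congr_of_eventuallyEq
        (glue_eventuallyEq_left P Q h)⟩
    · obtain ⟨v, hv, hd⟩ := dQ _ hx.2.2
      exact ⟨v, .inr hv, (hd.comp_sub_const x m).congr_of_eventuallyEq
        (glue_eventuallyEq_right P Q h)⟩

theorem norm_glue_sub_glue_le {P Q P' Q' : ℝ → Vec d} {δ δ' : ℝ} (m : ℝ)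
    (hP : ∀ x, ‖P x - P' x‖ ≤ δ) (hQ : ∀ x, ‖Q x - Q' x‖ ≤ δ') (x : ℝ) :
    ‖glue m P Q x - glue m P' Q' x‖ ≤ max δ δ' := by
  by_cases h : x ≤ m
  · simpa [glue, h] using .inl (hP (x - m))
  · simpa [glue, h] using .inr (hQ (x - m))

theorem hasDerivAt_smul_right (ξ : Vec d) (x : ℝ) : HasDerivAt (fun y : ℝ => y • ξ) ξ x := by
  simpa using (hasDerivAt_id x).smul_const ξ

theorem hasDerivIn_smul_right (ξ : Vec d) : HasDerivIn {ξ} fun x : ℝ => x • ξ :=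
  ⟨by fun_prop, ∅, Set.countable_empty, fun x _ => ⟨ξ, rfl, hasDerivAt_smul_right ξ x⟩⟩

/-! ### Necessity -/

theorem supFunctional_le_of_ae_mem {W : Vec d × Vec d → ℝ} {c : ℝ} {A : Set (Vec d)}
    (hA : A ×ˢ A ⊆ sublevel W c) {u : W1Inf a b d} (hu : ∀ᵐ x ∂(volI a b), u.weakDeriv x ∈ A) :
    supFunctional a b W u ≤ (c : EReal) := by
  rw [supFunctional_le_iff]
  filter_upwards [Measure.quasiMeasurePreserving_fst.ae hu,
    Measure.quasiMeasurePreserving_snd.ae hu] with z h1 h2 using hA ⟨h1, h2⟩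

/-- If the functional is at most `c` along oscillations between slopes in `A`, then `W ≤ c` holds
at pairs of convex combinations of two such slopes. -/
theorem SeqLowerSemicontinuous.convexJoin_prod_subset (hab : a < b) {W : Vec d × Vec d → ℝ}
    (hJ : SeqLowerSemicontinuous (supFunctional a b W)) {c : ℝ} {A : Set (Vec d)}
    (hA : A ×ˢ A ⊆ sublevel W c) :
    convexJoin ℝ A A ×ˢ convexJoin ℝ A A ⊆ sublevel W c := by
  rintro ⟨ξ, η⟩ ⟨hξ, hη⟩
  obtain ⟨p, hp, q, hq, t, t', ht0, ht0', htt, rfl⟩ := mem_convexJoin.mp hξ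
  obtain ⟨r, hr, s, hs, τ, τ', hτ0, hτ0', hττ, rfl⟩ := mem_convexJoin.mp hη
  obtain rfl : t' = 1 - t := by linarith
  obtain rfl : τ' = 1 - τ := by linarith
  set ξ := t • p + (1 - t) • q
  set η := τ • r + (1 - τ) • s
  have ht1 : t ≤ 1 := by linarith
  have hτ1 : τ ≤ 1 := by linarith
  -- Both sides of m have positive length, so the limit function takes each slope on a set of
  -- positive measure.
  obtain ⟨m, ham, hmb⟩ := exists_between hab
  let u : ℕ → ℝ → Vec d := fun k => glue m (zigzag t p q (k + 1)) (zigzag τ r s (k + 1))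
  let v : ℝ → Vec d := glue m (fun x => x • ξ) (fun x => x • η)
  have hpos : ∀ k : ℕ, (0 : ℝ) < k + 1 := fun k => by positivity
  have hu : ∀ k, HasDerivIn ({p, q} ∪ {r, s}) (u k) := fun k =>
    hasDerivIn_glue m (by rw [zigzag_zero ht0, zigzag_zero hτ0])
      (hasDerivIn_zigzag ht0 ht1 p q (hpos k).ne') (hasDerivIn_zigzag hτ0 hτ1 r s (hpos k).ne')
  have hv : HasDerivIn ({ξ} ∪ {η}) v :=
    hasDerivIn_glue m (by simp) (hasDerivIn_smul_right ξ) (hasDerivIn_smul_right η)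
  have hbu : Bornology.IsBounded ({p, q} ∪ {r, s} : Set (Vec d)) := (Set.toFinite _).isBounded
  have hbv : Bornology.IsBounded ({ξ} ∪ {η} : Set (Vec d)) := (Set.toFinite _).isBounded
  choose w hw hw' using fun k => (hu k).exists_w1Inf hab.le hbu
  obtain ⟨z, hz, hz'⟩ := hv.exists_w1Inf hab.le hbv
  have hinv : Tendsto (fun k : ℕ => ((k : ℝ) + 1)⁻¹) atTop (𝓝 0) := by
    simpa using tendsto_one_div_add_atTop_nhds_zero_nat (𝕜 := ℝ)
  have hδ : Tendsto (fun k : ℕ => max (((k : ℝ) + 1)⁻¹ * ‖p - q‖) (((k : ℝ) + 1)⁻¹ * ‖r - s‖))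
      atTop (𝓝 0) := by
    simpa using (hinv.mul_const ‖p - q‖).max (hinv.mul_const ‖r - s‖)
  have hlim : Tendsto w atTop (𝓝 z) :=
    W1Inf.tendsto_of_hasDerivIn hab.le hbu hbv hu hv hδ
      (fun k => norm_glue_sub_glue_le m (norm_zigzag_sub_le ht0 ht1 p q (hpos k))
        (norm_zigzag_sub_le hτ0 hτ1 r s (hpos k))) hw hw' hz hz'
  have hJw : ∀ k, supFunctional a b W (w k) ≤ (c : EReal) := fun k => by
    refine supFunctional_le_of_ae_mem hA ?_
    filter_upwards [hw' k, (hu k).ae_deriv_mem] with x h1 h2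
    rw [h1]
    revert h2
    generalize deriv (u k) x = y
    rintro ((rfl | rfl) | (rfl | rfl)) <;> assumption
  have hJz : supFunctional a b W z ≤ (c : EReal) :=
    (hJ w z hlim).trans <| (liminf_le_liminf (.of_forall hJw)).trans_eq (liminf_const _)
  rw [supFunctional_le_iff] at hJz
  have hfreq : ∀ α β : ℝ, α < β → Set.Ioo α β ⊆ Set.Ioo a b →
      ∃ᵐ x ∂(volI a b), x ∈ Set.Ioo α β := by
    intro α β hαβ hsub h
    rw [← measure_eq_zero_iff_ae_notMem, Measure.restrict_apply measurableSet_Ioo,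
      Set.inter_eq_left.mpr hsub] at h
    exact hαβ.not_ge (by simpa using h)
  -- Fubini again: a generic x left of m, then a generic y right of m, realises the pair (ξ, η).
  obtain ⟨x, hx, hx', hxz⟩ := ((hfreq a m ham (Set.Ioo_subset_Ioo_right hmb.le)).and_eventually
    (hz'.and (Measure.ae_ae_of_ae_prod hJz))).exists
  obtain ⟨y, hy, hy', hyz⟩ := ((hfreq m b hmb (Set.Ioo_subset_Ioo_left ham.le)).and_eventually
    (hz'.and hxz)).exists
  have e1 : deriv v x = ξ := (((hasDerivAt_smul_right ξ _).comp_sub_const x m).congr_of_eventuallyEq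
    (glue_eventuallyEq_left _ _ hx.2)).deriv
  have e2 : deriv v y = η := (((hasDerivAt_smul_right η _).comp_sub_const y m).congr_of_eventuallyEq
    (glue_eventuallyEq_right _ _ hy.1)).deriv
  rwa [hx', hy', e1, e2] at hyz

/-- A maximal M ⊇ A with M × M ⊆ E absorbs the segments between its points, hence is convex and
contains co A. -/
theorem cartesianConvex_of_convexJoin {E : Set (Vec d × Vec d)}
    (h : ∀ A : Set (Vec d), A ×ˢ A ⊆ E → convexJoin ℝ A A ×ˢ convexJoin ℝ A A ⊆ E) :
    CartesianConvex E := by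
  intro A hA
  obtain ⟨M, hAM, hM⟩ := zorn_subset_nonempty {A : Set (Vec d) | A ×ˢ A ⊆ E} (by
    intro C hC hchain hne
    refine ⟨⋃₀ C, ?_, fun s hs => Set.subset_sUnion_of_mem hs⟩
    rintro ⟨ξ, η⟩ ⟨⟨s, hs, hξ⟩, ⟨t, ht, hη⟩⟩
    -- Two points of the union of a chain lie in a common member.
    rcases hchain.total hs ht with hst | hts
    · exact hC ht ⟨hst hξ, hη⟩
    · exact hC hs ⟨hξ, hts hη⟩) A hA
  have hjoin : convexJoin ℝ M M ⊆ M := by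
    refine hM.le_of_ge (h M hM.prop) fun x hx => ?_
    exact mem_convexJoin.mpr ⟨x, hx, x, hx, left_mem_segment ℝ x x⟩
  have hconv : Convex ℝ M := convex_iff_segment_subset.mpr fun x hx y hy z hz =>
    hjoin (mem_convexJoin.mpr ⟨x, hx, y, hy, hz⟩)
  have hco : convexHull ℝ A ⊆ M := convexHull_min hAM hconv
  exact (Set.prod_mono hco hco).trans hM.prop

/-- Cartesian level convexity is necessary for sequential weak* lower semicontinuity. -/
theorem SeqLowerSemicontinuous.cartesianLevelConvex (hab : a < b) {W : Vec d × Vec d → ℝ}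
    (hJ : SeqLowerSemicontinuous (supFunctional a b W)) : CartesianLevelConvex W :=
  fun _ => cartesianConvex_of_convexJoin fun _ hA => hJ.convexJoin_prod_subset hab hA

end NonlocalSup

end

theorem theorem1p3 (d : ℕ) (a b : ℝ) (hab : a < b)
    (W : NonlocalSup.Vec d × NonlocalSup.Vec d → ℝ)
    (hcoer : NonlocalSup.IsCoercive W) (hlsc : LowerSemicontinuous W)
    (hdiag : NonlocalSup.IsDiag W) (hsymm : NonlocalSup.IsSymm W) :
    (LowerSemicontinuous (NonlocalSup.supFunctional a b W) ↔
        NonlocalSup.CartesianLevelConvex W) ∧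
      (NonlocalSup.SeqLowerSemicontinuous (NonlocalSup.supFunctional a b W) ↔
        NonlocalSup.CartesianLevelConvex W) :=
  ⟨⟨fun h => h.seqLowerSemicontinuous.cartesianLevelConvex hab,
      fun h => h.lowerSemicontinuous hab hlsc⟩,
    ⟨fun h => h.cartesianLevelConvex hab,
      fun h => (h.lowerSemicontinuous hab hlsc).seqLowerSemicontinuous⟩⟩
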